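/- For $\lambda\in\mathbb{R}$ let $\phi_\lambda:[0,1]\to[0,\infty]$ be $$\phi_\lambda(x)=\begin{cases}\dfrac{x^{\lambda+1}-x+\lambda(1-x)}{\lambda(\lambda+1)} & \lambda\neq -1,0,\\[1ex] 1-x+x\log x & \lambda=0,\\ x-1-\log x & \lambda=-1,\end{cases}$$ where $0\log 0=0$ and $\phi_\lambda(0)=\infty$ if $\lambda\le -1$ (so $\phi_\lambda(0)=1/(\lambda+1)$ if $\lambda>-1$). Its pseudoinverse is $\phi_\lambda^{[-1]}(t)=\phi_\lambda^{-1}(t)\in[0,1]$ for $0\le t<\phi_\lambda(0)$ and $\phi_\lambda^{[-1]}(t)=0$ for $\phi_\lambda(0)\le t\le\infty$. The power-divergence copula with parameter $\lambda$ is $$C_\lambda(u_1,u_2)=\phi_\lambda^{[-1]}\big(\phi_\lambda(u_1)+\phi_\lambda(u_2)\big),\qquad u_1,u_2\in[0,1],$$ and its zero curve is $\{(u_1,u_2)\in[0,1]^2:\phi_\lambda(u_1)+\phi_\lambda(u_2)=\phi_\lambda(0)\}$. **Theorem.** For every $\lambda\in\mathbb{R}$, $C_\lambda$ is a copula: there is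 exactly one probability measure $\mu_\lambda$ on $\mathbb{R}^2$ (the $C$-measure) whose two marginals are uniform on $[0,1]$ and which satisfies $\mu_\lambda([0,u_1]\times[0,u_2])=C_\lambda(u_1,u_2)$ for all $u_1,u_2\in[0,1]$. Moreover: 1. If $\lambda\le 0$, then $C_\lambda$ is absolutely continuous, that is, $\mu_\lambda$ is absolutely continuous with respect to Lebesgue measure on $\mathbb{R}^2$. 2. If $\lambda>0$, then the singular part of $\mu_\lambda$ with respect to Lebesgue measure is supported on the zero curve (its complement is a null set for the singular part) and has total mass $\lambda/(\lambda+1)\in(0,1)$; this is also the $C$-measure $\mu_\lambda$ of the zero curve. -/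

import Mathlib

open Set MeasureTheory
open scoped ENNReal

noncomputable section

/-- The convex function `φ_lam` of the power divergences, as a function with values in `[0, ∞]`:
its value at `0` is `∞` when `lam ≤ -1`. It is used for arguments in `[0, 1]`, where the real
expressions below are nonnegative, so that `ENNReal.ofReal` does not truncate. -/
def pdPhi (lam x : ℝ) : ℝ≥0∞ :=
  if lam ≤ -1 ∧ x = 0 then ∞
  else if lam = 0 then ENNReal.ofReal (1 - x + x * Real.log x)
  else if lam = -1 then ENNReal.ofReal (x - 1 - Real.log x)
  else ENNReal.ofReal (1 / (lam * (lam + 1)) * (x ^ (lam + 1) - x + lam * (1 - x)))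

/-- The pseudoinverse `ψ^[-1] : [0, ∞] → [0, 1]` of a function `ψ : [0, 1] → [0, ∞]`:
the point `x ∈ [0, 1]` with `ψ x = t` if `t < ψ 0`, and `0` if `ψ 0 ≤ t`. -/
def pseudoInverse (ψ : ℝ → ℝ≥0∞) (t : ℝ≥0∞) : ℝ :=
  if t < ψ 0 then Function.invFunOn ψ (Icc (0 : ℝ) 1) t else 0

/-- The bivariate function `C(u, v; ψ) = ψ^[-1](ψ u + ψ v)` generated by `ψ`. -/
def archimedeanCopula (ψ : ℝ → ℝ≥0∞) (u v : ℝ) : ℝ :=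
  pseudoInverse ψ (ψ u + ψ v)

/-- The zero curve `ψ u + ψ v = ψ 0`, `(u, v) ∈ [0, 1]²`. -/
def zeroCurve (ψ : ℝ → ℝ≥0∞) : Set (ℝ × ℝ) :=
  {p | p.1 ∈ Icc (0 : ℝ) 1 ∧ p.2 ∈ Icc (0 : ℝ) 1 ∧ ψ p.1 + ψ p.2 = ψ 0}

/-- The power-divergence copula `C_lam`. -/
def pdCopula (lam : ℝ) : ℝ → ℝ → ℝ := archimedeanCopula (pdPhi lam)

/-- `μ` is the `C`-measure of the bivariate copula `C`: the joint law of two random variables,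
each uniform on `[0, 1]`, whose joint distribution function is `C` on `[0, 1]²`.
(A function `C` on `[0, 1]²` is a copula exactly when there is such a `μ`.) -/
structure IsCMeasure (C : ℝ → ℝ → ℝ) (μ : Measure (ℝ × ℝ)) : Prop where
  isProbabilityMeasure : IsProbabilityMeasure μ
  map_fst : μ.map Prod.fst = volume.restrict (Icc (0 : ℝ) 1)
  map_snd : μ.map Prod.snd = volume.restrict (Icc (0 : ℝ) 1)
  apply_rect : ∀ u ∈ Icc (0 : ℝ) 1, ∀ v ∈ Icc (0 : ℝ) 1,
    μ.real (Icc 0 u ×ˢ Icc 0 v) = C u v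

end

/-!
The power-divergence copulas are Archimedean, so their `C`-measures can be described by simplex
mixtures. Write `φ` for `pdPhi lam` and `f` for its real version `pdReal lam`; then
`f' x = (x ^ lam - 1) / lam` (or `log x`), `f'' x = x ^ (lam - 1)`, so `φ` is strictly decreasing
and convex on `[0, 1]`.

*Existence.* The measure is the joint law of `(φ⁻¹ (S R), φ⁻¹ ((1 - S) R))`, where `S` is uniform
on `(0, 1)` and `R ≥ 0` is independent of `S`. Given `R = r`, the event `S r ≥ x`,
`(1 - S) r ≥ y` has probability `(1 - (x + y) / r)⁺` (`volume_simplex_slice`), so by the Galois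
connection `pseudoInverse_le_iff` the joint distribution function is `C` provided that
`E (1 - z / R)⁺ = φ⁻¹ z` (`lintegral_one_sub_div_pdReal`). With `R = φ T`, this determines the law
`pdRadial lam` of `T`: the density `f f'' / f' ^ 2` on `(0, 1)` and an atom at `0` of mass
`lim (-f / f')` at `0`, which is `lam / (lam + 1)` for `0 < lam` and `0` otherwise. The identity
is the fundamental theorem of calculus for the primitive `t - (f t - z) / f' t`, whose boundary
values come from the convexity inequality `pdReal_sub_le`.

*Absolute continuity.* On `(0, 1)²`, the map `(s, t) ↦ (φ⁻¹ (s φ t), φ⁻¹ ((1 - s) φ t))` has the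
differentiable left inverse `(u, v) ↦ (φ u / (φ u + φ v), φ⁻¹ (φ u + φ v))`. Differentiable maps
send null sets to null sets, so preimages of null sets are null
(`map_pdMap_absolutelyContinuous`), and the density of the radial law contributes an absolutely
continuous measure.

*Singular part.* The atom of the radial law is mapped into the zero curve, which is a Lebesgue
null set because its vertical sections have at most one point. Hence the contribution of the atom
is the singular part.

*Uniqueness* holds since a `C`-measure is supported on the unit square and determined by its
distribution function.
-/

section PowerDivergence

open Filter Topology

/-! ### Pseudoinverses of strictly decreasing functions -/

section PseudoInverse

variable {ψ : ℝ → ℝ≥0∞}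

lemma pseudoInverse_spec (hc : ContinuousOn ψ (Icc 0 1)) (h1 : ψ 1 = 0) {t : ℝ≥0∞}
    (ht : t < ψ 0) : pseudoInverse ψ t ∈ Icc (0 : ℝ) 1 ∧ ψ (pseudoInverse ψ t) = t := by
  have hex : ∃ x ∈ Icc (0 : ℝ) 1, ψ x = t :=
    intermediate_value_Icc' zero_le_one hc ⟨by simp [h1], ht.le⟩
  rw [pseudoInverse, if_pos ht]
  exact ⟨Function.invFunOn_mem hex, Function.invFunOn_eq hex⟩

lemma pseudoInverse_of_le {t : ℝ≥0∞} (ht : ψ 0 ≤ t) : pseudoInverse ψ t = 0 :=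
  if_neg ht.not_gt

lemma pseudoInverse_mem_Icc (hc : ContinuousOn ψ (Icc 0 1)) (h1 : ψ 1 = 0) (t : ℝ≥0∞) :
    pseudoInverse ψ t ∈ Icc (0 : ℝ) 1 := by
  rcases lt_or_ge t (ψ 0) with ht | ht
  · exact (pseudoInverse_spec hc h1 ht).1
  · simp [pseudoInverse_of_le ht]

lemma apply_pseudoInverse (hc : ContinuousOn ψ (Icc 0 1)) (h1 : ψ 1 = 0) {t : ℝ≥0∞}
    (ht : t ≤ ψ 0) : ψ (pseudoInverse ψ t) = t := by
  rcases ht.lt_or_eq with ht | ht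
  · exact (pseudoInverse_spec hc h1 ht).2
  · rw [pseudoInverse_of_le ht.ge, ht]

/-- The Galois connection between a decreasing `ψ` and its pseudoinverse. -/
lemma pseudoInverse_le_iff (ha : StrictAntiOn ψ (Icc 0 1)) (hc : ContinuousOn ψ (Icc 0 1))
    (h1 : ψ 1 = 0) {t : ℝ≥0∞} {u : ℝ} (hu : u ∈ Icc (0 : ℝ) 1) :
    pseudoInverse ψ t ≤ u ↔ ψ u ≤ t := by
  rcases lt_or_ge t (ψ 0) with ht | ht
  · obtain ⟨hm, he⟩ := pseudoInverse_spec hc h1 ht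
    rw [← ha.le_iff_ge hu hm, he]
  · rw [pseudoInverse_of_le ht]
    exact ⟨fun _ => (ha.antitoneOn (left_mem_Icc.2 zero_le_one) hu hu.1).trans ht, fun _ => hu.1⟩

lemma pseudoInverse_apply (ha : StrictAntiOn ψ (Icc 0 1)) (hc : ContinuousOn ψ (Icc 0 1))
    (h1 : ψ 1 = 0) {u : ℝ} (hu : u ∈ Icc (0 : ℝ) 1) : pseudoInverse ψ (ψ u) = u :=
  ha.injOn (pseudoInverse_mem_Icc hc h1 _) hu
    (apply_pseudoInverse hc h1 (ha.antitoneOn (left_mem_Icc.2 zero_le_one) hu hu.1))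

lemma antitone_pseudoInverse (ha : StrictAntiOn ψ (Icc 0 1)) (hc : ContinuousOn ψ (Icc 0 1))
    (h1 : ψ 1 = 0) : Antitone (pseudoInverse ψ) := by
  intro s t hst
  rw [pseudoInverse_le_iff ha hc h1 (pseudoInverse_mem_Icc hc h1 s)]
  exact ((pseudoInverse_le_iff ha hc h1 (pseudoInverse_mem_Icc hc h1 s)).1 le_rfl).trans hst

lemma pseudoInverse_mem_Ioo (hc : ContinuousOn ψ (Icc 0 1)) (h1 : ψ 1 = 0) {t : ℝ≥0∞}
    (h0 : 0 < t) (ht : t < ψ 0) : pseudoInverse ψ t ∈ Ioo (0 : ℝ) 1 := by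
  obtain ⟨hm, he⟩ := pseudoInverse_spec hc h1 ht
  refine ⟨hm.1.lt_of_ne ?_, hm.2.lt_of_ne ?_⟩
  · intro h
    rw [← h] at he
    exact ht.ne he.symm
  · intro h
    rw [h, h1] at he
    exact h0.ne he

end PseudoInverse

/-! ### The power-divergence generator as a real function -/

/-- The real-valued expression behind `pdPhi`; the two agree on `(0, 1]`, and at `0` if
`-1 < lam`. -/
noncomputable def pdReal (lam x : ℝ) : ℝ :=
  if lam = 0 then 1 - x + x * Real.log x
  else if lam = -1 then x - 1 - Real.log x
  else 1 / (lam * (lam + 1)) * (x ^ (lam + 1) - x + lam * (1 - x))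

/-- The derivative of `pdReal lam` on `(0, ∞)`. -/
noncomputable def pdDeriv (lam x : ℝ) : ℝ :=
  if lam = 0 then Real.log x else (x ^ lam - 1) / lam

variable {lam : ℝ}

lemma pdPhi_eq_ofReal {x : ℝ} (h : -1 < lam ∨ x ≠ 0) :
    pdPhi lam x = ENNReal.ofReal (pdReal lam x) := by
  have : ¬ (lam ≤ -1 ∧ x = 0) := by
    rintro ⟨h1, h2⟩
    rcases h with h | h
    · linarith
    · exact h h2
  simp only [pdPhi, pdReal, if_neg this]
  split_ifs <;> rfl

lemma pdReal_one (lam : ℝ) : pdReal lam 1 = 0 := by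
  simp [pdReal]

lemma pdDeriv_one (lam : ℝ) : pdDeriv lam 1 = 0 := by
  simp [pdDeriv]

lemma pdReal_zero (h : -1 < lam) : pdReal lam 0 = 1 / (lam + 1) := by
  unfold pdReal
  split_ifs with h0 h1
  · simp [h0]
  · linarith
  · have : lam + 1 ≠ 0 := by linarith
    rw [Real.zero_rpow this]
    field_simp
    ring

lemma hasDerivAt_pdReal (lam : ℝ) {x : ℝ} (hx : 0 < x) :
    HasDerivAt (pdReal lam) (pdDeriv lam x) x := by
  unfold pdDeriv
  split_ifs with h0
  · have : pdReal lam = fun x => 1 - x + x * Real.log x := by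
      funext x; simp [pdReal, h0]
    rw [this]
    refine (((hasDerivAt_id' x).const_sub 1).fun_add
      ((hasDerivAt_id' x).fun_mul (Real.hasDerivAt_log hx.ne'))).congr_deriv ?_
    field_simp
    ring
  · by_cases h1 : lam = -1
    · have : pdReal lam = fun x => x - 1 - Real.log x := by
        funext x; simp [pdReal, h1]
      rw [this]
      refine (((hasDerivAt_id' x).sub_const 1).fun_sub
        (Real.hasDerivAt_log hx.ne')).congr_deriv ?_
      rw [h1, Real.rpow_neg_one]
      ring
    · have h2 : lam + 1 ≠ 0 := fun h => h1 (by linarith)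
      have : pdReal lam = fun x => 1 / (lam * (lam + 1)) *
          (x ^ (lam + 1) - x + lam * (1 - x)) := by
        funext x; simp [pdReal, h0, h1]
      rw [this]
      refine ((((Real.hasDerivAt_rpow_const (p := lam + 1) (Or.inl hx.ne')).fun_sub
        (hasDerivAt_id' x)).fun_add (((hasDerivAt_id' x).const_sub 1).const_mul lam)).const_mul
          (1 / (lam * (lam + 1)))).congr_deriv ?_
      rw [add_sub_cancel_right]
      field_simp
      ring

lemma hasDerivAt_pdDeriv (lam : ℝ) {x : ℝ} (hx : 0 < x) :
    HasDerivAt (pdDeriv lam) (x ^ (lam - 1)) x := by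
  by_cases h0 : lam = 0
  · have : pdDeriv lam = Real.log := by funext x; simp [pdDeriv, h0]
    rw [this, h0, zero_sub, Real.rpow_neg_one]
    exact Real.hasDerivAt_log hx.ne'
  · have : pdDeriv lam = fun x => (x ^ lam - 1) / lam := by funext x; simp [pdDeriv, h0]
    rw [this]
    refine (((Real.hasDerivAt_rpow_const (p := lam) (Or.inl hx.ne')).sub_const 1).div_const
      lam).congr_deriv ?_
    field_simp

lemma strictMonoOn_pdDeriv (lam : ℝ) : StrictMonoOn (pdDeriv lam) (Ioi 0) := by
  refine strictMonoOn_of_deriv_pos (convex_Ioi 0)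
    (fun x hx => (hasDerivAt_pdDeriv lam hx).continuousAt.continuousWithinAt) fun x hx => ?_
  rw [interior_Ioi] at hx
  rw [(hasDerivAt_pdDeriv lam hx).deriv]
  exact Real.rpow_pos_of_pos hx _

lemma pdDeriv_neg {x : ℝ} (hx : x ∈ Ioo (0 : ℝ) 1) : pdDeriv lam x < 0 := by
  rw [← pdDeriv_one lam]
  exact strictMonoOn_pdDeriv lam hx.1 (mem_Ioi.2 one_pos) hx.2

lemma strictAntiOn_pdReal (lam : ℝ) : StrictAntiOn (pdReal lam) (Ioc 0 1) := by
  refine strictAntiOn_of_deriv_neg (convex_Ioc 0 1)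
    (fun x hx => (hasDerivAt_pdReal lam hx.1).continuousAt.continuousWithinAt) fun x hx => ?_
  rw [interior_Ioc] at hx
  rw [(hasDerivAt_pdReal lam hx.1).deriv]
  exact pdDeriv_neg hx

lemma pdReal_nonneg {x : ℝ} (hx : x ∈ Ioc (0 : ℝ) 1) : 0 ≤ pdReal lam x := by
  rw [← pdReal_one lam]
  exact (strictAntiOn_pdReal lam).antitoneOn hx (right_mem_Ioc.2 one_pos) hx.2

lemma pdReal_pos {x : ℝ} (hx : x ∈ Ioo (0 : ℝ) 1) : 0 < pdReal lam x := by
  rw [← pdReal_one lam]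
  exact strictAntiOn_pdReal lam ⟨hx.1, hx.2.le⟩ (right_mem_Ioc.2 one_pos) hx.2

/-- The tangent-line inequality for the convex function `pdReal lam`. -/
lemma pdReal_sub_le {s t : ℝ} (hs : 0 < s) (hst : s < t) :
    pdReal lam s - pdReal lam t ≤ -pdDeriv lam s * (t - s) := by
  obtain ⟨c, hc, he⟩ := exists_hasDerivAt_eq_slope (pdReal lam) (pdDeriv lam) hst
    (fun x hx => (hasDerivAt_pdReal lam (hs.trans_le hx.1)).continuousAt.continuousWithinAt)
    (fun x hx => hasDerivAt_pdReal lam (hs.trans hx.1))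
  have h1 : pdDeriv lam s ≤ pdDeriv lam c :=
    (strictMonoOn_pdDeriv lam).monotoneOn hs (mem_Ioi.2 (hs.trans hc.1)) hc.1.le
  have h2 : pdReal lam t - pdReal lam s = pdDeriv lam c * (t - s) := by
    rw [he, div_mul_cancel₀ _ (sub_pos.2 hst).ne']
  nlinarith [mul_le_mul_of_nonneg_right h1 (sub_pos.2 hst).le]

lemma tendsto_pdReal_nhdsGT_zero (h : -1 < lam) :
    Tendsto (pdReal lam) (𝓝[>] 0) (𝓝 (pdReal lam 0)) := by
  refine ContinuousAt.tendsto (f := pdReal lam) ?_ |>.mono_left nhdsWithin_le_nhds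
  have h1 : lam ≠ -1 := h.ne'
  by_cases h0 : lam = 0
  · have : pdReal lam = fun x => 1 - x + x * Real.log x := by
      funext x; simp [pdReal, h0]
    rw [this]
    exact ((continuous_const.sub continuous_id).add Real.continuous_mul_log).continuousAt
  · have : pdReal lam = fun x => 1 / (lam * (lam + 1)) *
        (x ^ (lam + 1) - x + lam * (1 - x)) := by
      funext x; simp [pdReal, h0, h1]
    rw [this]
    have : Continuous fun x : ℝ => x ^ (lam + 1) := Real.continuous_rpow_const (by linarith)
    exact Continuous.continuousAt (by fun_prop)

lemma tendsto_pdReal_atTop (h : lam ≤ -1) : Tendsto (pdReal lam) (𝓝[>] 0) atTop := by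
  have hid : ∀ a b : ℝ, Tendsto (fun x : ℝ => a * x + b) (𝓝[>] 0) (𝓝 b) := fun a b => by
    have : Continuous fun x : ℝ => a * x + b := by fun_prop
    simpa using (this.tendsto 0).mono_left nhdsWithin_le_nhds
  have h0 : lam ≠ 0 := by linarith
  rcases h.lt_or_eq with h1 | h1
  · have h2 : 0 < lam * (lam + 1) := mul_pos_of_neg_of_neg (by linarith) (by linarith)
    have : pdReal lam = fun x => 1 / (lam * (lam + 1)) *
        (((-1 - lam) * x + lam) + x ^ (lam + 1)) := by
      funext x; simp [pdReal, h0, h1.ne]; left; ring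
    rw [this]
    exact ((hid _ _).add_atTop (tendsto_rpow_neg_nhdsGT_zero (by linarith))).const_mul_atTop
      (by positivity)
  · have : pdReal lam = fun x => (1 * x + (-1)) + -Real.log x := by
      funext x; simp [pdReal, h1]; ring
    rw [this]
    exact (hid _ _).add_atTop (tendsto_neg_atBot_atTop.comp Real.tendsto_log_nhdsGT_zero)

lemma tendsto_pdDeriv_atBot (h : lam ≤ 0) : Tendsto (pdDeriv lam) (𝓝[>] 0) atBot := by
  rcases h.lt_or_eq with h0 | h0
  · have : pdDeriv lam = fun x => (1 / lam) * (-1 + x ^ lam) := by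
      funext x; simp [pdDeriv, h0.ne]; ring
    rw [this]
    exact (tendsto_const_nhds.add_atTop
      (tendsto_rpow_neg_nhdsGT_zero h0)).const_mul_atTop_of_neg (one_div_neg.2 h0)
  · have : pdDeriv lam = Real.log := by funext x; simp [pdDeriv, h0]
    rw [this]
    exact Real.tendsto_log_nhdsGT_zero

lemma tendsto_pdDeriv_of_pos (h : 0 < lam) :
    Tendsto (pdDeriv lam) (𝓝[>] 0) (𝓝 (-1 / lam)) := by
  have : pdDeriv lam = fun x => (x ^ lam - 1) / lam := by
    funext x; simp [pdDeriv, h.ne']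
  rw [this]
  have h2 : Continuous fun x : ℝ => (x ^ lam - 1) / lam :=
    ((Real.continuous_rpow_const h.le).sub continuous_const).div_const _
  simpa [Real.zero_rpow h.ne'] using (h2.tendsto 0).mono_left nhdsWithin_le_nhds

/-! ### The power-divergence generator with values in `[0, ∞]` -/

lemma pdPhi_one (lam : ℝ) : pdPhi lam 1 = 0 := by
  rw [pdPhi_eq_ofReal (Or.inr one_ne_zero), pdReal_one, ENNReal.ofReal_zero]

lemma pdPhi_ne_top {x : ℝ} (h : -1 < lam ∨ x ≠ 0) : pdPhi lam x ≠ ∞ := by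
  rw [pdPhi_eq_ofReal h]
  exact ENNReal.ofReal_ne_top

lemma tendsto_pdPhi_nhdsGT_zero (lam : ℝ) :
    Tendsto (pdPhi lam) (𝓝[>] 0) (𝓝 (pdPhi lam 0)) := by
  have he : (fun x => ENNReal.ofReal (pdReal lam x)) =ᶠ[𝓝[>] 0] pdPhi lam := by
    filter_upwards [self_mem_nhdsWithin] with x hx
    rw [pdPhi_eq_ofReal (Or.inr (ne_of_gt hx))]
  refine Tendsto.congr' he ?_
  rcases lt_or_ge (-1) lam with h | h
  · rw [pdPhi_eq_ofReal (Or.inl h)]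
    exact (ENNReal.continuous_ofReal.tendsto _).comp (tendsto_pdReal_nhdsGT_zero h)
  · rw [show pdPhi lam 0 = ∞ from if_pos ⟨h, rfl⟩]
    exact ENNReal.tendsto_ofReal_atTop.comp (tendsto_pdReal_atTop h)

lemma strictAntiOn_pdPhi (lam : ℝ) : StrictAntiOn (pdPhi lam) (Icc 0 1) := by
  have hpos : ∀ x ∈ Ioc (0 : ℝ) 1, ∀ y ∈ Ioc (0 : ℝ) 1, x < y → pdPhi lam y < pdPhi lam x := by
    intro x hx y hy hxy
    rw [pdPhi_eq_ofReal (Or.inr hx.1.ne'), pdPhi_eq_ofReal (Or.inr hy.1.ne')]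
    exact (ENNReal.ofReal_lt_ofReal_iff_of_nonneg (pdReal_nonneg hy)).2
      (strictAntiOn_pdReal lam hx hy hxy)
  intro x hx y hy hxy
  rcases hx.1.eq_or_lt with rfl | hx0
  · -- the value at `0` is the limit from the right, hence at least the value at `y / 2`
    refine (hpos (y / 2) ⟨by linarith, by linarith [hy.2]⟩ y ⟨hxy, hy.2⟩
      (by linarith)).trans_le ?_
    refine ge_of_tendsto (tendsto_pdPhi_nhdsGT_zero lam) ?_
    filter_upwards [Ioo_mem_nhdsGT (show (0 : ℝ) < y / 2 by linarith)] with z hz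
    exact (hpos z ⟨hz.1, by linarith [hz.2, hy.2]⟩ (y / 2)
      ⟨by linarith, by linarith [hy.2]⟩ hz.2).le
  · exact hpos x ⟨hx0, hx.2⟩ y ⟨hx0.trans hxy, hy.2⟩ hxy

lemma continuousOn_pdPhi (lam : ℝ) : ContinuousOn (pdPhi lam) (Icc 0 1) := by
  intro x hx
  rcases hx.1.eq_or_lt with rfl | hx0
  · have h : ContinuousWithinAt (pdPhi lam) (Ici 0) 0 := by
      rw [← continuousWithinAt_Ioi_iff_Ici]
      exact tendsto_pdPhi_nhdsGT_zero lam
    exact h.mono Icc_subset_Ici_self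
  · have he : (fun x => ENNReal.ofReal (pdReal lam x)) =ᶠ[𝓝 x] pdPhi lam := by
      filter_upwards [Ioi_mem_nhds hx0] with y hy
      rw [pdPhi_eq_ofReal (Or.inr (ne_of_gt hy))]
    refine (ContinuousAt.congr ?_ he).continuousWithinAt
    exact ENNReal.continuous_ofReal.continuousAt.comp (hasDerivAt_pdReal lam hx0).continuousAt

lemma measurable_pdPhi (lam : ℝ) : Measurable (pdPhi lam) := by
  unfold pdPhi
  refine Measurable.ite ?_ measurable_const ?_
  · by_cases h : lam ≤ -1 <;> simp [h]
  · split_ifs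
    · fun_prop
    · fun_prop
    · exact ENNReal.measurable_ofReal.comp (by fun_prop)

/-! ### The radial law -/

/-- The mass `max lam 0 / (lam + 1)` of the atom of the radial law at the value `φ 0`; it is
`lam / (lam + 1)` for `0 < lam` and `0` otherwise. -/
noncomputable def pdAtom (lam : ℝ) : ℝ := max lam 0 / (lam + 1)

/-- The density of the radial law, in the coordinate `t = φ⁻¹ r` on `(0, 1)`:
it is the derivative `φ φ'' / φ'²` of `t - φ t / φ' t`. -/
noncomputable def pdDensity (lam t : ℝ) : ℝ :=
  pdReal lam t * t ^ (lam - 1) / pdDeriv lam t ^ 2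

lemma pdAtom_nonneg (lam : ℝ) : 0 ≤ pdAtom lam := by
  unfold pdAtom
  rcases le_total lam 0 with h | h
  · simp [max_eq_right h]
  · positivity

lemma pdAtom_of_nonpos (h : lam ≤ 0) : pdAtom lam = 0 := by
  simp [pdAtom, max_eq_right h]

lemma pdAtom_of_pos (h : 0 < lam) : pdAtom lam = lam / (lam + 1) := by
  simp [pdAtom, max_eq_left h.le]

lemma tendsto_neg_inv_pdDeriv (lam : ℝ) :
    Tendsto (fun t => -(pdDeriv lam t)⁻¹) (𝓝[>] 0) (𝓝 (max lam 0)) := by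
  rcases le_or_gt lam 0 with h | h
  · rw [max_eq_right h]
    simpa using (tendsto_inv_atBot_zero.comp (tendsto_pdDeriv_atBot h)).neg
  · rw [max_eq_left h.le]
    have h0 : -1 / lam ≠ 0 := div_ne_zero (by norm_num) h.ne'
    have := ((tendsto_pdDeriv_of_pos h).inv₀ h0).neg
    rwa [show -(-1 / lam)⁻¹ = lam by simp [neg_div]] at this

lemma tendsto_neg_pdReal_div_pdDeriv (lam : ℝ) :
    Tendsto (fun t => -(pdReal lam t / pdDeriv lam t)) (𝓝[>] 0) (𝓝 (pdAtom lam)) := by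
  rcases le_or_gt lam 0 with h | h
  · rw [pdAtom_of_nonpos h]
    have h01 : Ioo (0 : ℝ) 1 ∈ 𝓝[>] (0 : ℝ) := Ioo_mem_nhdsGT one_pos
    refine tendsto_order.2 ⟨fun a ha => ?_, fun ε hε => ?_⟩
    · filter_upwards [h01] with t ht
      exact ha.trans_le (neg_nonneg.2 (div_nonpos_of_nonneg_of_nonpos
        (pdReal_pos ht).le (pdDeriv_neg ht).le))
    · -- by convexity `-φ t / φ' t ≤ δ - φ δ / φ' t` for `t < δ`, and `1 / φ' t → 0`
      have hδ : 0 < ε / 2 := by linarith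
      have hlim := (tendsto_neg_inv_pdDeriv lam).const_mul (pdReal lam (ε / 2))
      rw [max_eq_right h, mul_zero] at hlim
      filter_upwards [h01, Ioo_mem_nhdsGT hδ, hlim.eventually_lt_const hδ] with t ht1 ht2 ht3
      have hd := pdDeriv_neg (lam := lam) ht1
      have hs := pdReal_sub_le (lam := lam) ht2.1 ht2.2
      have hi : 0 < -(pdDeriv lam t)⁻¹ := neg_pos.2 (inv_lt_zero.2 hd)
      have := mul_le_mul_of_nonneg_right hs hi.le
      have he : -pdDeriv lam t * (ε / 2 - t) * -(pdDeriv lam t)⁻¹ = ε / 2 - t := by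
        field_simp [hd.ne]
      rw [he, sub_mul] at this
      rw [div_eq_mul_inv, ← mul_neg]
      linarith [ht2.1]
  · have := ((tendsto_pdReal_nhdsGT_zero (show -1 < lam by linarith)).mul
      (tendsto_neg_inv_pdDeriv lam))
    rw [pdReal_zero (by linarith), max_eq_left h.le, one_div_mul_eq_div] at this
    rw [pdAtom_of_pos h]
    refine this.congr fun t => ?_
    rw [mul_neg, div_eq_mul_inv]

/-- The function `t - (φ t - φ w) / φ' t` is a primitive of `(φ t - φ w) φ'' t / φ' t ^ 2` on
`(0, w)`, tends to `w` at `w`, and to the subtracted term below at `0`. -/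
lemma lintegral_pdReal_sub {w : ℝ} (hw : w ∈ Ioc (0 : ℝ) 1) :
    0 ≤ w - (pdAtom lam - max lam 0 * pdReal lam w) ∧
    ∫⁻ t in Ioo 0 w, ENNReal.ofReal
        ((pdReal lam t - pdReal lam w) * t ^ (lam - 1) / pdDeriv lam t ^ 2) =
      ENNReal.ofReal (w - (pdAtom lam - max lam 0 * pdReal lam w)) := by
  set P : ℝ → ℝ := fun t => t - (pdReal lam t - pdReal lam w) / pdDeriv lam t with hP
  set P' : ℝ → ℝ := fun t =>
    (pdReal lam t - pdReal lam w) * t ^ (lam - 1) / pdDeriv lam t ^ 2 with hP'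
  have hsub : ∀ t ∈ Ioo 0 w, t ∈ Ioo (0 : ℝ) 1 := fun t ht => ⟨ht.1, ht.2.trans_le hw.2⟩
  have hgt : ∀ t ∈ Ioo 0 w, pdReal lam w < pdReal lam t := fun t ht =>
    strictAntiOn_pdReal lam ⟨ht.1, (hsub t ht).2.le⟩ hw ht.2
  have hderiv : ∀ t ∈ Ioo 0 w, HasDerivAt P (P' t) t := by
    intro t ht
    have hd := (pdDeriv_neg (lam := lam) (hsub t ht)).ne
    refine ((hasDerivAt_id' t).fun_sub (((hasDerivAt_pdReal lam ht.1).sub_const _).fun_div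
      (hasDerivAt_pdDeriv lam ht.1) hd)).congr_deriv ?_
    simp only [hP']
    field_simp
    ring
  have hnn : ∀ t ∈ Ioo 0 w, 0 ≤ P' t := fun t ht =>
    div_nonneg (mul_nonneg (sub_pos.2 (hgt t ht)).le (Real.rpow_nonneg ht.1.le _))
      (sq_nonneg _)
  have hleft : Tendsto P (𝓝[>] 0) (𝓝 (pdAtom lam - max lam 0 * pdReal lam w)) := by
    have h0 : Tendsto (fun t : ℝ => t) (𝓝[>] 0) (𝓝 0) := nhdsWithin_le_nhds
    have := (h0.add (tendsto_neg_pdReal_div_pdDeriv lam)).sub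
      ((tendsto_neg_inv_pdDeriv lam).mul_const (pdReal lam w))
    rw [zero_add] at this
    refine this.congr fun t => ?_
    simp only [hP]
    ring
  have hright : Tendsto P (𝓝[<] w) (𝓝 w) := by
    have h0 : Tendsto (fun t : ℝ => t) (𝓝[<] w) (𝓝 w) := nhdsWithin_le_nhds
    have hmem : Ioo 0 w ∈ 𝓝[<] w := Ioo_mem_nhdsLT hw.1
    refine tendsto_of_tendsto_of_tendsto_of_le_of_le' h0 tendsto_const_nhds ?_ ?_
    · filter_upwards [hmem] with t ht
      have := div_nonpos_of_nonneg_of_nonpos (sub_pos.2 (hgt t ht)).le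
        (pdDeriv_neg (lam := lam) (hsub t ht)).le
      simp only [hP]
      linarith
    · filter_upwards [hmem] with t ht
      have hd := pdDeriv_neg (lam := lam) (hsub t ht)
      have hs := pdReal_sub_le (lam := lam) ht.1 ht.2
      have : -(w - t) ≤ (pdReal lam t - pdReal lam w) / pdDeriv lam t := by
        rw [le_div_iff_of_neg hd]
        linarith
      simp only [hP]
      linarith
  have hcont : ContinuousOn P (Ioo 0 w) :=
    fun t ht => (hderiv t ht).continuousAt.continuousWithinAt
  have hint : IntegrableOn P' (Ioc 0 w) := by
    refine intervalIntegral.integrableOn_deriv_of_nonneg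
      (continuousOn_Icc_extendFrom_Ioo hcont hleft hright) (fun t ht => ?_) hnn
    refine (hderiv t ht).congr_of_eventuallyEq ?_
    filter_upwards [Ioo_mem_nhds ht.1 ht.2] with s hs
    exact extendFrom_eq (subset_closure hs) (hcont s hs)
  have hFTC := intervalIntegral.integral_eq_sub_of_hasDerivAt_of_tendsto hw.1 hderiv
    ((intervalIntegrable_iff_integrableOn_Ioc_of_le hw.1.le).2 hint) hleft hright
  rw [intervalIntegral.integral_of_le hw.1.le, integral_Ioc_eq_integral_Ioo] at hFTC
  refine ⟨hFTC ▸ setIntegral_nonneg measurableSet_Ioo hnn, ?_⟩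
  rw [← hFTC, ofReal_integral_eq_lintegral_ofReal (hint.mono_set Ioo_subset_Ioc_self)]
  exact (ae_restrict_iff' measurableSet_Ioo).2 (ae_of_all _ hnn)

lemma measurable_pdReal (lam : ℝ) : Measurable (pdReal lam) := by
  unfold pdReal
  split_ifs <;> fun_prop

lemma measurable_pdDeriv (lam : ℝ) : Measurable (pdDeriv lam) := by
  unfold pdDeriv
  split_ifs <;> fun_prop

lemma measurable_pdDensity (lam : ℝ) : Measurable (pdDensity lam) := by
  unfold pdDensity
  have := measurable_pdReal lam
  have := measurable_pdDeriv lam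
  fun_prop

/-- The law of `t = φ⁻¹ r`, where `r` follows the radial law of the copula: a density on `(0, 1)`
and an atom at `0`. -/
noncomputable def pdRadial (lam : ℝ) : Measure ℝ :=
  (volume.restrict (Ioo (0 : ℝ) 1)).withDensity (fun t => ENNReal.ofReal (pdDensity lam t)) +
    ENNReal.ofReal (pdAtom lam) • Measure.dirac 0

instance (lam : ℝ) : SFinite (pdRadial lam) := by
  unfold pdRadial; infer_instance

lemma ofReal_mul_pdDensity {t z : ℝ} (ht : t ∈ Ioo (0 : ℝ) 1) :
    ENNReal.ofReal (pdDensity lam t) * ENNReal.ofReal (1 - z / pdReal lam t) =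
      ENNReal.ofReal ((pdReal lam t - z) * t ^ (lam - 1) / pdDeriv lam t ^ 2) := by
  have hf := pdReal_pos (lam := lam) ht
  have : 0 ≤ pdDensity lam t :=
    div_nonneg (mul_nonneg hf.le (Real.rpow_nonneg ht.1.le _)) (sq_nonneg _)
  rw [← ENNReal.ofReal_mul this]
  congr 1
  unfold pdDensity
  field_simp

lemma lintegral_pdRadial (lam : ℝ) {g : ℝ → ℝ≥0∞} (hg : Measurable g) :
    ∫⁻ t, g t ∂(pdRadial lam) =
      (∫⁻ t in Ioo 0 1, ENNReal.ofReal (pdDensity lam t) * g t) +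
        ENNReal.ofReal (pdAtom lam) * g 0 := by
  rw [pdRadial, lintegral_add_measure, lintegral_smul_measure, lintegral_dirac,
    lintegral_withDensity_eq_lintegral_mul _ (measurable_pdDensity lam).ennreal_ofReal hg]
  rfl

/-- The generator is the Williamson transform of its radial law: `∫ (1 - z / φ t)⁺` is
`φ⁻¹ z`. -/
lemma lintegral_one_sub_div_pdReal {w : ℝ} (hw : w ∈ Ioc (0 : ℝ) 1) :
    ∫⁻ t, ENNReal.ofReal (1 - pdReal lam w / pdReal lam t) ∂(pdRadial lam) =
      ENNReal.ofReal w := by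
  have hm : Measurable fun t => ENNReal.ofReal (1 - pdReal lam w / pdReal lam t) := by
    have := measurable_pdReal lam
    fun_prop
  rw [lintegral_pdRadial lam hm]
  have hac : ∫⁻ t in Ioo 0 1, ENNReal.ofReal (pdDensity lam t) *
      ENNReal.ofReal (1 - pdReal lam w / pdReal lam t) =
      ENNReal.ofReal (w - (pdAtom lam - max lam 0 * pdReal lam w)) := by
    rw [← (lintegral_pdReal_sub hw).2, ← lintegral_indicator measurableSet_Ioo,
      ← lintegral_indicator measurableSet_Ioo]
    congr 1
    funext t
    by_cases ht : t ∈ Ioo (0 : ℝ) 1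
    · rw [indicator_of_mem ht, ofReal_mul_pdDensity ht]
      by_cases htw : t < w
      · rw [indicator_of_mem (show t ∈ Ioo 0 w from ⟨ht.1, htw⟩)]
      · rw [indicator_of_notMem (fun h => htw h.2)]
        refine ENNReal.ofReal_of_nonpos (div_nonpos_of_nonpos_of_nonneg
          (mul_nonpos_of_nonpos_of_nonneg (sub_nonpos.2 ?_)
            (Real.rpow_nonneg ht.1.le _)) (sq_nonneg _))
        exact (strictAntiOn_pdReal lam).antitoneOn hw ⟨ht.1, ht.2.le⟩ (not_lt.1 htw)
    · rw [indicator_of_notMem ht,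
        indicator_of_notMem (fun h => ht ⟨h.1, h.2.trans_le hw.2⟩)]
  have hatom : ENNReal.ofReal (pdAtom lam) *
      ENNReal.ofReal (1 - pdReal lam w / pdReal lam 0) =
      ENNReal.ofReal (pdAtom lam - max lam 0 * pdReal lam w) := by
    rw [← ENNReal.ofReal_mul (pdAtom_nonneg lam)]
    congr 1
    rcases le_or_gt lam 0 with h | h
    · simp [pdAtom_of_nonpos h, max_eq_right h]
    · rw [pdReal_zero (by linarith), pdAtom_of_pos h, max_eq_left h.le]
      field_simp
  have hatom_nn : 0 ≤ pdAtom lam - max lam 0 * pdReal lam w := by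
    rcases le_or_gt lam 0 with h | h
    · simp [pdAtom_of_nonpos h, max_eq_right h]
    · have hlt : pdReal lam w ≤ pdReal lam 0 := by
        refine ge_of_tendsto (tendsto_pdReal_nhdsGT_zero (by linarith)) ?_
        filter_upwards [Ioo_mem_nhdsGT hw.1] with s hs
        exact (strictAntiOn_pdReal lam).antitoneOn ⟨hs.1, hs.2.le.trans hw.2⟩ hw hs.2.le
      rw [pdReal_zero (by linarith)] at hlt
      rw [pdAtom_of_pos h, max_eq_left h.le, div_eq_mul_one_div]
      linarith [mul_le_mul_of_nonneg_left hlt h.le]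
  have hac_nn := (lintegral_pdReal_sub (lam := lam) hw).1
  rw [hac, hatom, ← ENNReal.ofReal_add hac_nn hatom_nn, sub_add_cancel]

/-! ### The joint law -/

/-- If `t` is distributed according to `pdRadial lam` and `s` is uniform and independent, the
image of `(s, t)` is `(φ⁻¹ (s r), φ⁻¹ ((1 - s) r))` with `r = φ t`. -/
noncomputable def pdMap (lam : ℝ) (p : ℝ × ℝ) : ℝ × ℝ :=
  (pseudoInverse (pdPhi lam) (ENNReal.ofReal p.1 * pdPhi lam p.2),
    pseudoInverse (pdPhi lam) (ENNReal.ofReal (1 - p.1) * pdPhi lam p.2))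

/-- The `C`-measure of the power-divergence copula. -/
noncomputable def pdMeasure (lam : ℝ) : Measure (ℝ × ℝ) :=
  ((volume.restrict (Ioo (0 : ℝ) 1)).prod (pdRadial lam)).map (pdMap lam)

lemma measurable_pdMap (lam : ℝ) : Measurable (pdMap lam) := by
  have h1 := (antitone_pseudoInverse (strictAntiOn_pdPhi lam) (continuousOn_pdPhi lam)
    (pdPhi_one lam)).measurable
  have h2 := measurable_pdPhi lam
  exact (h1.comp (by fun_prop)).prodMk (h1.comp (by fun_prop))

lemma pdMap_mem_unitSquare (lam : ℝ) (p : ℝ × ℝ) :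
    pdMap lam p ∈ Icc (0 : ℝ) 1 ×ˢ Icc (0 : ℝ) 1 :=
  ⟨pseudoInverse_mem_Icc (continuousOn_pdPhi lam) (pdPhi_one lam) _,
    pseudoInverse_mem_Icc (continuousOn_pdPhi lam) (pdPhi_one lam) _⟩

lemma pdPhi_le_pdPhi_zero {x : ℝ} (hx : x ∈ Icc (0 : ℝ) 1) : pdPhi lam x ≤ pdPhi lam 0 :=
  (strictAntiOn_pdPhi lam).antitoneOn (left_mem_Icc.2 zero_le_one) hx hx.1

lemma pdPhi_lt_pdPhi_zero {x : ℝ} (hx : x ∈ Ioc (0 : ℝ) 1) : pdPhi lam x < pdPhi lam 0 :=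
  strictAntiOn_pdPhi lam (left_mem_Icc.2 zero_le_one) (Ioc_subset_Icc_self hx) hx.1

lemma ae_pdRadial (lam : ℝ) :
    ∀ᵐ t ∂(pdRadial lam), t ∈ Ico (0 : ℝ) 1 ∧ 0 < pdReal lam t ∧
      pdPhi lam t = ENNReal.ofReal (pdReal lam t) := by
  rw [pdRadial, ae_add_measure_iff]
  constructor
  · refine (withDensity_absolutelyContinuous _ _).ae_le ?_
    filter_upwards [ae_restrict_mem measurableSet_Ioo] with t ht
    exact ⟨⟨ht.1.le, ht.2⟩, pdReal_pos ht, pdPhi_eq_ofReal (Or.inr ht.1.ne')⟩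
  · rcases le_or_gt lam 0 with h | h
    · simp [pdAtom_of_nonpos h]
    · refine (Measure.AbsolutelyContinuous.rfl.smul_left _).ae_le ?_
      have h1 : (-1 : ℝ) < lam := by linarith
      have h2 : 0 < pdReal lam 0 := by rw [pdReal_zero h1]; positivity
      exact (ae_dirac_eq (0 : ℝ)).symm ▸
        (show _ ∧ _ ∧ _ from ⟨⟨le_rfl, one_pos⟩, h2, pdPhi_eq_ofReal (Or.inl h1)⟩)

/-- For `s` uniform on `(0, 1)`, the law of `(s r, (1 - s) r)` gives mass `(1 - (x + y) / r)⁺` to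
`[x, ∞) × [y, ∞)`. -/
lemma volume_simplex_slice {r x y : ℝ} (hr : 0 < r) (hx : 0 ≤ x) (hy : 0 ≤ y) :
    volume.restrict (Ioo (0 : ℝ) 1)
      {s | ENNReal.ofReal x ≤ ENNReal.ofReal s * ENNReal.ofReal r ∧
        ENNReal.ofReal y ≤ ENNReal.ofReal (1 - s) * ENNReal.ofReal r} =
      ENNReal.ofReal (1 - (x + y) / r) := by
  have hms : MeasurableSet {s | ENNReal.ofReal x ≤ ENNReal.ofReal s * ENNReal.ofReal r ∧
        ENNReal.ofReal y ≤ ENNReal.ofReal (1 - s) * ENNReal.ofReal r} := by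
    rw [ofPred_and]
    exact (measurableSet_le measurable_const (by fun_prop)).inter
      (measurableSet_le measurable_const (by fun_prop))
  rw [Measure.restrict_congr_set Ioo_ae_eq_Icc, Measure.restrict_apply hms]
  have : {s | ENNReal.ofReal x ≤ ENNReal.ofReal s * ENNReal.ofReal r ∧
      ENNReal.ofReal y ≤ ENNReal.ofReal (1 - s) * ENNReal.ofReal r} ∩ Icc 0 1 =
      Icc (x / r) (1 - y / r) := by
    have key : ∀ s ∈ Icc (0 : ℝ) 1, (ENNReal.ofReal x ≤ ENNReal.ofReal s * ENNReal.ofReal r ∧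
        ENNReal.ofReal y ≤ ENNReal.ofReal (1 - s) * ENNReal.ofReal r) ↔
        s ∈ Icc (x / r) (1 - y / r) := by
      intro s hs
      have h1 : 0 ≤ 1 - s := sub_nonneg.2 hs.2
      rw [← ENNReal.ofReal_mul hs.1, ← ENNReal.ofReal_mul h1,
        ENNReal.ofReal_le_ofReal_iff (mul_nonneg hs.1 hr.le),
        ENNReal.ofReal_le_ofReal_iff (mul_nonneg h1 hr.le), ← div_le_iff₀ hr, ← div_le_iff₀ hr,
        mem_Icc, le_sub_comm]
    ext s
    refine ⟨fun h => (key s h.2).1 h.1, fun h => ?_⟩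
    have hs : s ∈ Icc (0 : ℝ) 1 :=
      ⟨(div_nonneg hx hr.le).trans h.1, h.2.trans (sub_le_self _ (div_nonneg hy hr.le))⟩
    exact ⟨(key s hs).2 h, hs⟩
  rw [this, Real.volume_Icc]
  congr 1
  ring

lemma pdCopula_mem_Icc (lam u v : ℝ) : pdCopula lam u v ∈ Icc (0 : ℝ) 1 :=
  pseudoInverse_mem_Icc (continuousOn_pdPhi lam) (pdPhi_one lam) _

lemma pdCopula_one_right {u : ℝ} (hu : u ∈ Icc (0 : ℝ) 1) : pdCopula lam u 1 = u := by
  rw [pdCopula, archimedeanCopula, pdPhi_one, add_zero]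
  exact pseudoInverse_apply (strictAntiOn_pdPhi lam) (continuousOn_pdPhi lam) (pdPhi_one lam) hu

lemma pdCopula_comm (lam u v : ℝ) : pdCopula lam u v = pdCopula lam v u := by
  rw [pdCopula, archimedeanCopula, archimedeanCopula, add_comm]

lemma pdMeasure_rect_of_pos {u v : ℝ} (hu : u ∈ Ioc (0 : ℝ) 1) (hv : v ∈ Ioc (0 : ℝ) 1) :
    pdMeasure lam (Icc 0 u ×ˢ Icc 0 v) = ENNReal.ofReal (pdCopula lam u v) := by
  have ha := strictAntiOn_pdPhi lam
  have hc := continuousOn_pdPhi lam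
  have h1 := pdPhi_one lam
  have hms : MeasurableSet (Icc 0 u ×ˢ Icc 0 v) := measurableSet_Icc.prod measurableSet_Icc
  rw [pdMeasure, Measure.map_apply (measurable_pdMap lam) hms,
    Measure.prod_apply_symm (measurable_pdMap lam hms)]
  have hxu := pdPhi_eq_ofReal (lam := lam) (Or.inr hu.1.ne')
  have hyv := pdPhi_eq_ofReal (lam := lam) (Or.inr hv.1.ne')
  have hx := pdReal_nonneg (lam := lam) hu
  have hy := pdReal_nonneg (lam := lam) hv
  have hsum : pdPhi lam u + pdPhi lam v = ENNReal.ofReal (pdReal lam u + pdReal lam v) := by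
    rw [hxu, hyv, ENNReal.ofReal_add hx hy]
  have hslice : ∀ᵐ t ∂(pdRadial lam), volume.restrict (Ioo (0 : ℝ) 1)
      ((fun s => (s, t)) ⁻¹' (pdMap lam ⁻¹' (Icc 0 u ×ˢ Icc 0 v))) =
      ENNReal.ofReal (1 - (pdReal lam u + pdReal lam v) / pdReal lam t) := by
    filter_upwards [ae_pdRadial lam] with t ht
    rw [← volume_simplex_slice ht.2.1 hx hy, ← ht.2.2, ← hxu, ← hyv]
    congr 1
    ext s
    rw [mem_ofPred_eq, ← pseudoInverse_le_iff ha hc h1 (Ioc_subset_Icc_self hu),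
      ← pseudoInverse_le_iff ha hc h1 (Ioc_subset_Icc_self hv)]
    have := pdMap_mem_unitSquare lam (s, t)
    exact ⟨fun h => ⟨h.1.2, h.2.2⟩, fun h => ⟨⟨this.1.1, h.1⟩, ⟨this.2.1, h.2⟩⟩⟩
  rw [lintegral_congr_ae hslice]
  rcases lt_or_ge (pdPhi lam u + pdPhi lam v) (pdPhi lam 0) with h | h
  · obtain ⟨hm, he⟩ := pseudoInverse_spec hc h1 h
    change pdCopula lam u v ∈ _ at hm
    change pdPhi lam (pdCopula lam u v) = _ at he
    have hw : pdCopula lam u v ∈ Ioc (0 : ℝ) 1 := by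
      refine ⟨hm.1.lt_of_ne fun h0 => ?_, hm.2⟩
      rw [← h0] at he
      exact h.ne he.symm
    have hfw : pdReal lam (pdCopula lam u v) = pdReal lam u + pdReal lam v := by
      rw [hsum, pdPhi_eq_ofReal (Or.inr hw.1.ne')] at he
      exact (ENNReal.ofReal_eq_ofReal_iff (pdReal_nonneg hw) (add_nonneg hx hy)).1 he
    rw [← hfw, lintegral_one_sub_div_pdReal hw]
  · rw [pdCopula, archimedeanCopula, pseudoInverse_of_le h, ENNReal.ofReal_zero]
    refine (lintegral_congr_ae ?_).trans lintegral_zero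
    filter_upwards [ae_pdRadial lam] with t ht
    refine ENNReal.ofReal_of_nonpos ?_
    have := (pdPhi_le_pdPhi_zero (lam := lam) (Ico_subset_Icc_self ht.1)).trans h
    rw [ht.2.2, hsum, ENNReal.ofReal_le_ofReal_iff (add_nonneg hx hy)] at this
    rw [sub_nonpos, one_le_div ht.2.1]
    exact this

lemma pdMeasure_rect {u v : ℝ} (hu : u ∈ Icc (0 : ℝ) 1) (hv : v ∈ Icc (0 : ℝ) 1) :
    pdMeasure lam (Icc 0 u ×ˢ Icc 0 v) = ENNReal.ofReal (pdCopula lam u v) := by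
  -- if `u` or `v` vanishes, the rectangle lies in strips of arbitrarily small mass
  have hsmall : ∀ s : Set (ℝ × ℝ),
      (∀ ε ∈ Ioc (0 : ℝ) 1, pdMeasure lam s ≤ ENNReal.ofReal ε) → pdMeasure lam s = 0 := by
    intro s hs
    refine le_antisymm (ge_of_tendsto (f := fun ε : ℝ => ENNReal.ofReal ε) (x := 𝓝[>] 0)
      ?_ ?_) bot_le
    · have := (ENNReal.continuous_ofReal.tendsto 0).mono_left
        (nhdsWithin_le_nhds (s := Ioi (0 : ℝ)))
      rwa [ENNReal.ofReal_zero] at this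
    · filter_upwards [Ioo_mem_nhdsGT (one_pos : (0 : ℝ) < 1)] with ε hε
      exact hs ε ⟨hε.1, hε.2.le⟩
  have hzero : ∀ v, pdCopula lam 0 v = 0 := fun v => pseudoInverse_of_le le_self_add
  rcases hu.1.eq_or_lt with rfl | hu0
  · rw [hzero, ENNReal.ofReal_zero]
    refine hsmall _ fun ε hε => ?_
    refine (measure_mono (prod_mono (Icc_subset_Icc_right hε.1.le)
      (Icc_subset_Icc_right hv.2))).trans_eq
        ((pdMeasure_rect_of_pos hε (right_mem_Ioc.2 one_pos)).trans ?_)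
    rw [pdCopula_one_right (Ioc_subset_Icc_self hε)]
  · rcases hv.1.eq_or_lt with rfl | hv0
    · rw [pdCopula_comm, hzero, ENNReal.ofReal_zero]
      refine hsmall _ fun ε hε => ?_
      refine (measure_mono (prod_mono (Icc_subset_Icc_right hu.2)
        (Icc_subset_Icc_right hε.1.le))).trans_eq
          ((pdMeasure_rect_of_pos (right_mem_Ioc.2 one_pos) hε).trans ?_)
      rw [pdCopula_comm, pdCopula_one_right (Ioc_subset_Icc_self hε)]
    · exact pdMeasure_rect_of_pos ⟨hu0, hu.2⟩ ⟨hv0, hv.2⟩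

lemma pdMeasure_compl_unitSquare (lam : ℝ) :
    pdMeasure lam (Icc (0 : ℝ) 1 ×ˢ Icc (0 : ℝ) 1)ᶜ = 0 := by
  rw [pdMeasure, Measure.map_apply (measurable_pdMap lam)
    (measurableSet_Icc.prod measurableSet_Icc).compl]
  refine measure_mono_null (fun p hp => ?_) measure_empty
  exact hp (pdMap_mem_unitSquare lam p)

lemma Iic_inter_unitInterval {a : ℝ} : Iic a ∩ Icc (0 : ℝ) 1 = Icc 0 (min a 1) := by
  ext x; simp only [mem_inter_iff, mem_Iic, mem_Icc, le_min_iff]; tauto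

/-- A measure on `ℝ` supported on `[0, 1]` is Lebesgue measure on `[0, 1]` as soon as it gives
mass `u` to `[0, u]`. -/
lemma eq_volume_restrict_Icc {ρ : Measure ℝ} (h0 : ρ (Icc 0 1)ᶜ = 0)
    (h : ∀ u ∈ Icc (0 : ℝ) 1, ρ (Icc 0 u) = ENNReal.ofReal u) :
    ρ = volume.restrict (Icc (0 : ℝ) 1) := by
  refine (Measure.ext_of_Iic _ _ fun a => ?_).symm
  rw [Measure.restrict_apply measurableSet_Iic, ← measure_inter_conull h0 (s := Iic a),
    Iic_inter_unitInterval, Real.volume_Icc, sub_zero]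
  rcases lt_or_ge a 0 with ha | ha
  · have : min a 1 < 0 := (min_le_left _ _).trans_lt ha
    rw [Icc_eq_empty (not_le.2 this), measure_empty, ENNReal.ofReal_of_nonpos this.le]
  · exact (h _ ⟨le_min ha zero_le_one, min_le_right _ _⟩).symm

lemma isCMeasure_pdMeasure (lam : ℝ) : IsCMeasure (pdCopula lam) (pdMeasure lam) := by
  have h0 := pdMeasure_compl_unitSquare lam
  have h1 : (1 : ℝ) ∈ Icc (0 : ℝ) 1 := right_mem_Icc.2 zero_le_one
  have hms : MeasurableSet (Icc (0 : ℝ) 1) := measurableSet_Icc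
  have hfst : ∀ u : ℝ, Prod.fst ⁻¹' Icc 0 u ∩ Icc (0 : ℝ) 1 ×ˢ Icc (0 : ℝ) 1 =
      (Icc 0 u ∩ Icc 0 1) ×ˢ Icc 0 1 := by
    intro u; ext p; simp only [mem_inter_iff, mem_preimage, mem_prod]; tauto
  have hsnd : ∀ u : ℝ, Prod.snd ⁻¹' Icc 0 u ∩ Icc (0 : ℝ) 1 ×ˢ Icc (0 : ℝ) 1 =
      Icc 0 1 ×ˢ (Icc 0 u ∩ Icc 0 1) := by
    intro u; ext p; simp only [mem_inter_iff, mem_preimage, mem_prod]; tauto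
  refine ⟨⟨?_⟩, eq_volume_restrict_Icc ?_ fun u hu => ?_, eq_volume_restrict_Icc ?_ fun u hu => ?_,
    fun u hu v hv => ?_⟩
  · rw [← measure_inter_conull h0, univ_inter, pdMeasure_rect h1 h1, pdCopula_one_right h1,
      ENNReal.ofReal_one]
  · rw [Measure.map_apply measurable_fst hms.compl]
    refine measure_mono_null (fun p hp => ?_) h0
    exact fun h => hp h.1
  · rw [Measure.map_apply measurable_fst measurableSet_Icc, ← measure_inter_conull h0, hfst,
      inter_eq_left.2 (Icc_subset_Icc_right hu.2), pdMeasure_rect hu h1, pdCopula_one_right hu]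
  · rw [Measure.map_apply measurable_snd hms.compl]
    refine measure_mono_null (fun p hp => ?_) h0
    exact fun h => hp h.2
  · rw [Measure.map_apply measurable_snd measurableSet_Icc, ← measure_inter_conull h0, hsnd,
      inter_eq_left.2 (Icc_subset_Icc_right hu.2), pdMeasure_rect h1 hu, pdCopula_comm,
      pdCopula_one_right hu]
  · rw [measureReal_def, pdMeasure_rect hu hv, ENNReal.toReal_ofReal (pdCopula_mem_Icc lam u v).1]

/-! ### Uniqueness of the `C`-measure -/

lemma IsCMeasure.compl_unitSquare {C : ℝ → ℝ → ℝ} {μ : Measure (ℝ × ℝ)} (h : IsCMeasure C μ) :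
    μ (Icc (0 : ℝ) 1 ×ˢ Icc (0 : ℝ) 1)ᶜ = 0 := by
  have hms : MeasurableSet (Icc (0 : ℝ) 1)ᶜ := measurableSet_Icc.compl
  have h1 : μ (Prod.fst ⁻¹' (Icc (0 : ℝ) 1)ᶜ) = 0 := by
    rw [← Measure.map_apply measurable_fst hms, h.map_fst, Measure.restrict_apply hms]
    simp
  have h2 : μ (Prod.snd ⁻¹' (Icc (0 : ℝ) 1)ᶜ) = 0 := by
    rw [← Measure.map_apply measurable_snd hms, h.map_snd, Measure.restrict_apply hms]
    simp
  refine measure_mono_null (fun p hp => ?_) (measure_union_null h1 h2)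
  by_contra hn
  simp only [mem_union, mem_preimage, not_or, notMem_compl_iff] at hn
  exact hp hn

lemma IsCMeasure.unique {C : ℝ → ℝ → ℝ} {μ ν : Measure (ℝ × ℝ)} (hμ : IsCMeasure C μ)
    (hν : IsCMeasure C ν) : ν = μ := by
  have := hμ.isProbabilityMeasure
  have := hν.isProbabilityMeasure
  have hspan : IsCountablySpanning (range (Iic : ℝ → Set ℝ)) :=
    ⟨fun n : ℕ => Iic (n : ℝ), fun n => mem_range_self _, by
      rw [eq_univ_iff_forall]
      intro x
      obtain ⟨n, hn⟩ := exists_nat_ge x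
      exact mem_iUnion.2 ⟨n, hn⟩⟩
  have hgen : (Prod.instMeasurableSpace : MeasurableSpace (ℝ × ℝ)) =
      MeasurableSpace.generateFrom
        (image2 (· ×ˢ ·) (range (Iic : ℝ → Set ℝ)) (range (Iic : ℝ → Set ℝ))) := by
    rw [← generateFrom_prod_eq hspan hspan, ← borel_eq_generateFrom_Iic,
      ← BorelSpace.measurable_eq (α := ℝ)]
  refine ext_of_generate_finite _ hgen (isPiSystem_Iic.prod isPiSystem_Iic) ?_ (by simp)
  rintro _ ⟨_, ⟨a, rfl⟩, _, ⟨b, rfl⟩, rfl⟩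
  simp only
  rw [← measure_inter_conull hμ.compl_unitSquare, ← measure_inter_conull hν.compl_unitSquare,
    prod_inter_prod, Iic_inter_unitInterval, Iic_inter_unitInterval]
  rcases lt_or_ge a 0 with ha | ha
  · simp [Icc_eq_empty (not_le.2 ((min_le_left a 1).trans_lt ha))]
  rcases lt_or_ge b 0 with hb | hb
  · simp [Icc_eq_empty (not_le.2 ((min_le_left b 1).trans_lt hb))]
  have h1 := hμ.apply_rect (min a 1) ⟨le_min ha zero_le_one, min_le_right _ _⟩
    (min b 1) ⟨le_min hb zero_le_one, min_le_right _ _⟩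
  have h2 := hν.apply_rect (min a 1) ⟨le_min ha zero_le_one, min_le_right _ _⟩
    (min b 1) ⟨le_min hb zero_le_one, min_le_right _ _⟩
  rw [← h1, measureReal_def, measureReal_def,
    ENNReal.toReal_eq_toReal_iff' (measure_ne_top _ _) (measure_ne_top _ _)] at h2
  exact h2

/-! ### The absolutely continuous and the singular part -/

lemma differentiableAt_pseudoInverse_pdPhi {w : ℝ} (hw : w ∈ Ioo (0 : ℝ) 1) :
    DifferentiableAt ℝ (fun z => pseudoInverse (pdPhi lam) (ENNReal.ofReal z))
      (pdReal lam w) := by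
  have hs : HasStrictDerivAt (pdReal lam) (pdDeriv lam w) w :=
    hasStrictDerivAt_of_hasDerivAt_of_continuousAt
      (by filter_upwards [Ioi_mem_nhds hw.1] with x hx using hasDerivAt_pdReal lam hx)
      (hasDerivAt_pdDeriv lam hw.1).continuousAt
  refine (hs.to_local_left_inverse (pdDeriv_neg hw).ne ?_).hasDerivAt.differentiableAt
  filter_upwards [Ioo_mem_nhds hw.1 hw.2] with x hx
  rw [← pdPhi_eq_ofReal (Or.inr hx.1.ne')]
  exact pseudoInverse_apply (strictAntiOn_pdPhi lam) (continuousOn_pdPhi lam) (pdPhi_one lam)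
    ⟨hx.1.le, hx.2.le⟩

/-- On the open unit square `pdMap lam` has the differentiable left inverse
`(u, v) ↦ (φ u / (φ u + φ v), φ⁻¹ (φ u + φ v))`, so preimages of null sets are null. -/
lemma map_pdMap_absolutelyContinuous (lam : ℝ) :
    ((volume.restrict (Ioo (0 : ℝ) 1)).prod (volume.restrict (Ioo (0 : ℝ) 1))).map (pdMap lam) ≪
      (volume : Measure (ℝ × ℝ)) := by
  have ha := strictAntiOn_pdPhi lam
  have hc := continuousOn_pdPhi lam
  have h1 := pdPhi_one lam
  refine Measure.AbsolutelyContinuous.mk fun N hN hN0 => ?_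
  rw [Measure.map_apply (measurable_pdMap lam) hN, Measure.prod_restrict,
    Measure.restrict_apply (measurable_pdMap lam hN)]
  set H : ℝ × ℝ → ℝ × ℝ := fun p => (pdReal lam p.1 / (pdReal lam p.1 + pdReal lam p.2),
    pseudoInverse (pdPhi lam) (ENNReal.ofReal (pdReal lam p.1 + pdReal lam p.2))) with hH
  set D : Set (ℝ × ℝ) := {p | p.1 ∈ Ioo (0 : ℝ) 1 ∧ p.2 ∈ Ioo (0 : ℝ) 1 ∧
    ∃ w ∈ Ioo (0 : ℝ) 1, pdReal lam p.1 + pdReal lam p.2 = pdReal lam w} with hD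
  have hdiff : DifferentiableOn ℝ H (N ∩ D) := by
    rintro p ⟨-, hp1, hp2, w, hw, hpw⟩
    refine DifferentiableAt.differentiableWithinAt ?_
    have d1 : DifferentiableAt ℝ (fun p : ℝ × ℝ => pdReal lam p.1) p :=
      (hasDerivAt_pdReal lam hp1.1).differentiableAt.comp p differentiableAt_fst
    have d2 : DifferentiableAt ℝ (fun p : ℝ × ℝ => pdReal lam p.2) p :=
      (hasDerivAt_pdReal lam hp2.1).differentiableAt.comp p differentiableAt_snd
    have d3 := differentiableAt_pseudoInverse_pdPhi (lam := lam) hw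
    rw [← hpw] at d3
    have hne : pdReal lam p.1 + pdReal lam p.2 ≠ 0 :=
      (add_pos (pdReal_pos hp1) (pdReal_pos hp2)).ne'
    have d4 : DifferentiableAt ℝ
        (fun p : ℝ × ℝ => pdReal lam p.1 / (pdReal lam p.1 + pdReal lam p.2)) p := by
      simp only [div_eq_mul_inv]
      exact d1.fun_mul ((d1.fun_add d2).fun_inv hne)
    have d5 : DifferentiableAt ℝ
        ((fun z => pseudoInverse (pdPhi lam) (ENNReal.ofReal z)) ∘
          fun p : ℝ × ℝ => pdReal lam p.1 + pdReal lam p.2) p :=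
      DifferentiableAt.comp p d3 (d1.fun_add d2)
    exact d4.prodMk d5
  refine measure_mono_null ?_ (addHaar_image_eq_zero_of_differentiableOn_of_addHaar_eq_zero
    volume hdiff (measure_mono_null inter_subset_left hN0))
  -- the preimage of `N` lies in `H '' (N ∩ D)`, since `H (pdMap lam (s, t)) = (s, t)`
  rintro ⟨s, t⟩ ⟨hst, hs, ht⟩
  have hf := pdReal_pos (lam := lam) ht
  have hpt := pdPhi_eq_ofReal (lam := lam) (Or.inr ht.1.ne')
  have hlt := pdPhi_lt_pdPhi_zero (lam := lam) (Ioo_subset_Ioc_self ht)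
  have hinv : ∀ c ∈ Ioo (0 : ℝ) 1,
      pseudoInverse (pdPhi lam) (ENNReal.ofReal c * pdPhi lam t) ∈ Ioo (0 : ℝ) 1 ∧
      pdReal lam (pseudoInverse (pdPhi lam) (ENNReal.ofReal c * pdPhi lam t)) =
        c * pdReal lam t := by
    intro c hc'
    have hpos : 0 < c * pdReal lam t := mul_pos hc'.1 hf
    rw [hpt, ← ENNReal.ofReal_mul hc'.1.le]
    have hlt' : ENNReal.ofReal (c * pdReal lam t) < pdPhi lam 0 := by
      refine lt_of_le_of_lt ?_ hlt
      rw [hpt]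
      exact ENNReal.ofReal_le_ofReal (mul_le_of_le_one_left hf.le hc'.2.le)
    have hm := pseudoInverse_mem_Ioo hc h1 (ENNReal.ofReal_pos.2 hpos) hlt'
    refine ⟨hm, ?_⟩
    have he := (pseudoInverse_spec hc h1 hlt').2
    rw [pdPhi_eq_ofReal (Or.inr hm.1.ne')] at he
    exact (ENNReal.ofReal_eq_ofReal_iff (pdReal_pos hm).le hpos.le).1 he
  obtain ⟨hu, hfu⟩ := hinv s hs
  obtain ⟨hv, hfv⟩ := hinv (1 - s) ⟨sub_pos.2 hs.2, sub_lt_self _ hs.1⟩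
  have hsum : pdReal lam (pdMap lam (s, t)).1 + pdReal lam (pdMap lam (s, t)).2 =
      pdReal lam t := by
    simp only [pdMap]
    rw [hfu, hfv]
    ring
  refine ⟨pdMap lam (s, t), ⟨hst, hu, hv, t, ht, hsum⟩, ?_⟩
  simp only [hH, hsum]
  refine Prod.ext ?_ ?_
  · simp only [pdMap]
    rw [hfu, mul_div_cancel_right₀ _ hf.ne']
  · simp only
    rw [← hpt]
    exact pseudoInverse_apply ha hc h1 ⟨ht.1.le, ht.2.le⟩

/-- The part of the `C`-measure coming from the density of the radial law. -/
noncomputable def pdMeasureAC (lam : ℝ) : Measure (ℝ × ℝ) :=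
  ((volume.restrict (Ioo (0 : ℝ) 1)).prod ((volume.restrict (Ioo (0 : ℝ) 1)).withDensity
    (fun t => ENNReal.ofReal (pdDensity lam t)))).map (pdMap lam)

/-- The part of the `C`-measure coming from the atom of the radial law. -/
noncomputable def pdMeasureSing (lam : ℝ) : Measure (ℝ × ℝ) :=
  ((volume.restrict (Ioo (0 : ℝ) 1)).prod
    (ENNReal.ofReal (pdAtom lam) • Measure.dirac (0 : ℝ))).map (pdMap lam)

lemma pdMeasure_eq_add (lam : ℝ) : pdMeasure lam = pdMeasureAC lam + pdMeasureSing lam := by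
  rw [pdMeasure, pdRadial, Measure.prod_add, Measure.map_add _ _ (measurable_pdMap lam)]
  rfl

lemma pdMeasureAC_absolutelyContinuous (lam : ℝ) : pdMeasureAC lam ≪ volume :=
  ((Measure.AbsolutelyContinuous.rfl.prod (withDensity_absolutelyContinuous _ _)).map
    (measurable_pdMap lam)).trans (map_pdMap_absolutelyContinuous lam)

lemma measurableSet_zeroCurve (lam : ℝ) : MeasurableSet (zeroCurve (pdPhi lam)) := by
  have := measurable_pdPhi lam
  exact (measurable_fst measurableSet_Icc).inter ((measurable_snd measurableSet_Icc).inter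
    (measurableSet_eq_fun (by fun_prop) measurable_const))

/-- If `φ` is finite on `[0, 1]`, each vertical section of the zero curve has at most one
point. -/
lemma volume_zeroCurve (h : -1 < lam) : volume (zeroCurve (pdPhi lam)) = 0 := by
  rw [Measure.volume_eq_prod, Measure.measure_prod_null (measurableSet_zeroCurve lam)]
  refine ae_of_all _ fun u => Set.Subsingleton.measure_zero ?_ _
  rintro v ⟨-, hv, hev⟩ v' ⟨-, hv', hev'⟩
  refine (strictAntiOn_pdPhi lam).injOn hv hv' ?_
  exact (ENNReal.add_right_inj (pdPhi_ne_top (Or.inl h))).1 (hev.trans hev'.symm)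

lemma pdMap_zero_mem_zeroCurve {s : ℝ} (hs : s ∈ Ioo (0 : ℝ) 1) :
    pdMap lam (s, 0) ∈ zeroCurve (pdPhi lam) := by
  have hm := pdMap_mem_unitSquare lam (s, 0)
  have h1 : 0 ≤ 1 - s := sub_nonneg.2 hs.2.le
  refine ⟨hm.1, hm.2, ?_⟩
  simp only [pdMap]
  rw [apply_pseudoInverse (continuousOn_pdPhi lam) (pdPhi_one lam),
    apply_pseudoInverse (continuousOn_pdPhi lam) (pdPhi_one lam), ← add_mul,
    ← ENNReal.ofReal_add hs.1.le h1, add_sub_cancel, ENNReal.ofReal_one, one_mul]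
  · exact mul_le_of_le_one_left bot_le (ENNReal.ofReal_le_one.2 (by linarith [hs.1]))
  · exact mul_le_of_le_one_left bot_le (ENNReal.ofReal_le_one.2 hs.2.le)

lemma pdMeasureSing_eq (lam : ℝ) : pdMeasureSing lam = ENNReal.ofReal (pdAtom lam) •
    (volume.restrict (Ioo (0 : ℝ) 1)).map (fun s => pdMap lam (s, 0)) := by
  rw [pdMeasureSing, Measure.prod_smul_right, Measure.map_smul, Measure.prod_dirac,
    Measure.map_map (measurable_pdMap lam) (by fun_prop)]
  rfl

lemma pdMeasureSing_compl_zeroCurve (lam : ℝ) :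
    pdMeasureSing lam (zeroCurve (pdPhi lam))ᶜ = 0 := by
  have hm : Measurable fun s : ℝ => pdMap lam (s, 0) := (measurable_pdMap lam).comp (by fun_prop)
  have hz := (measurableSet_zeroCurve lam).compl
  rw [pdMeasureSing_eq, Measure.smul_apply, Measure.map_apply hm hz,
    Measure.restrict_apply (hm hz)]
  have : (fun s : ℝ => pdMap lam (s, 0)) ⁻¹' (zeroCurve (pdPhi lam))ᶜ ∩ Ioo 0 1 = ∅ :=
    eq_empty_of_forall_notMem fun s hs => hs.1 (pdMap_zero_mem_zeroCurve hs.2)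
  rw [this, measure_empty, smul_zero]

lemma pdMeasureSing_zeroCurve (lam : ℝ) :
    pdMeasureSing lam (zeroCurve (pdPhi lam)) = ENNReal.ofReal (pdAtom lam) := by
  have hm : Measurable fun s : ℝ => pdMap lam (s, 0) := (measurable_pdMap lam).comp (by fun_prop)
  have hz := measurableSet_zeroCurve lam
  rw [pdMeasureSing_eq, Measure.smul_apply, Measure.map_apply hm hz,
    Measure.restrict_apply (hm hz)]
  have : (fun s : ℝ => pdMap lam (s, 0)) ⁻¹' (zeroCurve (pdPhi lam)) ∩ Ioo 0 1 = Ioo 0 1 :=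
    inter_eq_right.2 fun s hs => pdMap_zero_mem_zeroCurve hs
  rw [this, Real.volume_Ioo, sub_zero, ENNReal.ofReal_one, smul_eq_mul, mul_one]

instance (lam : ℝ) : SFinite (pdMeasureSing lam) := by
  unfold pdMeasureSing; infer_instance

instance (lam : ℝ) : SFinite (pdMeasureAC lam) := by
  unfold pdMeasureAC; infer_instance

lemma singularPart_pdMeasure (h : -1 < lam) :
    (pdMeasure lam).singularPart volume = pdMeasureSing lam := by
  have hs : pdMeasureSing lam ⟂ₘ volume :=
    ⟨(zeroCurve (pdPhi lam))ᶜ, (measurableSet_zeroCurve lam).compl,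
      pdMeasureSing_compl_zeroCurve lam, by rw [compl_compl]; exact volume_zeroCurve h⟩
  rw [pdMeasure_eq_add, Measure.singularPart_add,
    Measure.singularPart_eq_zero_of_ac (pdMeasureAC_absolutelyContinuous lam),
    Measure.singularPart_eq_self.2 hs, zero_add]

end PowerDivergence

theorem mainTheorem1 (lam : ℝ) :
    ∃ μ : Measure (ℝ × ℝ),
      IsCMeasure (pdCopula lam) μ ∧
      (∀ ν : Measure (ℝ × ℝ), IsCMeasure (pdCopula lam) ν → ν = μ) ∧
      (lam ≤ 0 → μ ≪ volume) ∧
      (0 < lam →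
        (μ.singularPart volume) (zeroCurve (pdPhi lam))ᶜ = 0 ∧
        (μ.singularPart volume) (zeroCurve (pdPhi lam)) = ENNReal.ofReal (lam / (lam + 1)) ∧
        μ (zeroCurve (pdPhi lam)) = ENNReal.ofReal (lam / (lam + 1)) ∧
        lam / (lam + 1) ∈ Ioo (0 : ℝ) 1) := by
  refine ⟨pdMeasure lam, isCMeasure_pdMeasure lam,
    fun ν hν => (isCMeasure_pdMeasure lam).unique hν, fun h => ?_, fun h => ?_⟩
  · rw [pdMeasure_eq_add, pdMeasureSing_eq, pdAtom_of_nonpos h, ENNReal.ofReal_zero, zero_smul,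
      add_zero]
    exact pdMeasureAC_absolutelyContinuous lam
  · have h1 : -1 < lam := by linarith
    rw [singularPart_pdMeasure h1, pdMeasureSing_compl_zeroCurve, pdMeasureSing_zeroCurve,
      pdAtom_of_pos h]
    refine ⟨rfl, rfl, ?_, by positivity, (div_lt_one (by linarith)).2 (by linarith)⟩
    rw [pdMeasure_eq_add, Measure.add_apply, pdMeasureSing_zeroCurve, pdAtom_of_pos h,
      pdMeasureAC_absolutelyContinuous lam (volume_zeroCurve h1), zero_add]
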